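/- **Theorem (horizontal selections: absolute continuity).** Let $N\ge 1$, let $\lambda=(\lambda_1,\dots,\lambda_N)$ satisfy $\lambda_i\ge 0$ and $\sum_{i}\lambda_i=1$, and let $\nu_1,\dots,\nu_N$ be Borel probability measures on $\mathbb{R}$ with finite first moment. For $x\in\mathbb{R}^N$ define the lower and upper weighted medians $$M^-_\lambda(x)=\inf\Big\{y\in\mathbb{R}:\sum_{i:\,x_i\le y}\lambda_i\ge\tfrac12\Big\},\qquad M^+_\lambda(x)=\sup\Big\{y\in\mathbb{R}:\sum_{i:\,x_i<y}\lambda_i\le\tfrac12\Big\}.$$ Let $F_\nu(x)=\nu((-\infty,x])$ and $Q_\nu(t)=\inf\{x\in\mathbb{R}: F_\nu(x)\ge t\}$ for $t\in(0,1)$ be the distribution and quantile functions of a probability measure $\nu$ on $\mathbb{R}$. For $\theta\in[0,1]$ let $\mu^\theta$ be the horizontal median selection, i.e. the probability measure on $\mathbb{R}$ whose quantile function on $(0,1)$ is $$Q_\theta(t)=(1-\theta)\,M^-_\lambda\big(Q_{\nu_1}(t),\dots,Q_{\nu_N}(t)\big)+\theta\,M^+_\lambda\big(Q_{\nu_1}(t),\dots,Q_{\nu_N}(t)\big);$$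 equivalently, $\mu^\theta$ is the image by $Q_\theta$ of the Lebesgue measure on $(0,1)$. Suppose that $\nu_1,\dots,\nu_N$ are absolutely continuous with respect to the Lebesgue measure on $\mathbb{R}$, with (nonnegative) densities $f_1,\dots,f_N\in L^1(\mathbb{R})$. Then: 1. $\mu^0$ and $\mu^1$ are absolutely continuous with densities $f_{\mu^0},f_{\mu^1}$ which satisfy $$\min_{1\le i\le N}f_i\le\min(f_{\mu^0},f_{\mu^1})\le\max(f_{\mu^0},f_{\mu^1})\le\max_{1\le i\le N}f_i\quad\text{a.e. on }\mathbb{R};$$ 2. for every $\theta\in[0,1]$, $\mu^\theta$ is absolutely continuous; denote its density by $f_{\mu^\theta}$; 3. if, for some $p\in[1,\infty]$, $f_i\in L^p(\mathbb{R})$ for $i=1,\dots,N$, then for every $\theta\in[0,1]$, $f_{\mu^\theta}\in L^p(\mathbb{R})$ and $$\|f_{\mu^\theta}\|_{L^p(\mathbb{R})}\le\Big\|\max_{1\le i\le N}f_i\Big\|_{L^p(\mathbb{R})}\le\sum_{i=1}^N\|f_i\|_{L^p(\mathbb{R})}.$$ -/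

import Mathlib

open MeasureTheory ProbabilityTheory Set
open scoped ENNReal

namespace HorizontalMedian

/-- The lower weighted median `M⁻(x)` of the sample `x` with weights `lam`. -/
noncomputable def lowerMedian {N : ℕ} (lam x : Fin N → ℝ) : ℝ :=
  sInf {y : ℝ | 1 / 2 ≤ ∑ i with x i ≤ y, lam i}

/-- The upper weighted median `M⁺(x)` of the sample `x` with weights `lam`. -/
noncomputable def upperMedian {N : ℕ} (lam x : Fin N → ℝ) : ℝ :=
  sSup {y : ℝ | ∑ i with x i < y, lam i ≤ 1 / 2}

/-- The quantile distribution function (pseudo-inverse of the cumulative distribution function)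
of a probability measure on the line. It is only used for `t` in `(0,1)`, where the set below
is nonempty and bounded below, so that the real infimum is the genuine one. -/
noncomputable def quantile (ν : Measure ℝ) (t : ℝ) : ℝ :=
  sInf {x : ℝ | t ≤ cdf ν x}

/-- `Q_θ = (1 - θ) Q⁻ + θ Q⁺`, where `Q⁻(t)` and `Q⁺(t)` are the lower and upper medians of the
quantiles of the sample measures at `t`; meant for `t` in `(0,1)`. -/
noncomputable def medianQuantile {N : ℕ} (lam : Fin N → ℝ) (ν : Fin N → Measure ℝ) (θ t : ℝ) : ℝ :=
  (1 - θ) * lowerMedian lam (fun i => quantile (ν i) t)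
    + θ * upperMedian lam (fun i => quantile (ν i) t)

/-- The horizontal median selection: the measure with quantile function `Q_θ`, that is, the image
by `Q_θ` of the Lebesgue measure on `(0,1)`. The theorems `isProbabilityMeasure_hMed` and
`quantile_hMed` below show that it is a probability measure with quantile function `Q_θ`. -/
noncomputable def hMed {N : ℕ} (lam : Fin N → ℝ) (ν : Fin N → Measure ℝ) (θ : ℝ) : Measure ℝ :=
  Measure.map (medianQuantile lam ν θ) (volume.restrict (Ioo (0 : ℝ) 1))

/-- `f` is a (real-valued, integrable, a.e. nonnegative) density of `μ` with respect to the
Lebesgue measure. -/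
structure IsDensity (f : ℝ → ℝ) (μ : Measure ℝ) : Prop where
  integrable : Integrable f volume
  nonneg : ∀ᵐ x ∂(volume : Measure ℝ), 0 ≤ f x
  eq_withDensity : μ = volume.withDensity (fun x => ENNReal.ofReal (f x))

theorem quantile_le_iff (ν : Measure ℝ) {t : ℝ} (ht : t ∈ Ioo (0 : ℝ) 1) (x : ℝ) :
    quantile ν t ≤ x ↔ t ≤ cdf ν x := by
  have hne : {x : ℝ | t ≤ cdf ν x}.Nonempty :=
    (((tendsto_cdf_atTop ν).eventually (lt_mem_nhds ht.2)).mono fun _ h => le_of_lt h).exists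
  obtain ⟨b, hb⟩ := Filter.eventually_atBot.1
    ((tendsto_cdf_atBot ν).eventually (gt_mem_nhds ht.1))
  have hbdd : BddBelow {x : ℝ | t ≤ cdf ν x} :=
    ⟨b, fun y hy => le_of_not_ge fun h => absurd (hb y h) (not_lt.2 hy)⟩
  refine ⟨fun h => ?_, fun h => csInf_le hbdd h⟩
  have hgt : ∀ y, x < y → t ≤ cdf ν y := by
    intro y hy
    obtain ⟨z, hz, hzy⟩ := exists_lt_of_csInf_lt hne (lt_of_le_of_lt h hy)
    exact le_trans hz (monotone_cdf ν hzy.le)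
  have hc : Filter.Tendsto (cdf ν) (nhdsWithin x (Ioi x)) (nhds (cdf ν x)) :=
    ((cdf ν).right_continuous x).mono_left (nhdsWithin_mono _ Ioi_subset_Ici_self)
  exact ge_of_tendsto hc (Filter.eventually_of_mem self_mem_nhdsWithin fun y hy => hgt y hy)

theorem sum_filter_mono {N : ℕ} {lam : Fin N → ℝ} (h0 : ∀ i, 0 ≤ lam i) {p q : Fin N → Prop}
    [DecidablePred p] [DecidablePred q] (h : ∀ i, p i → q i) :
    ∑ i with p i, lam i ≤ ∑ i with q i, lam i :=
  Finset.sum_le_sum_of_subset_of_nonneg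
    (fun i hi => by simp only [Finset.mem_filter, Finset.mem_univ, true_and] at hi ⊢; exact h i hi)
    (fun i _ _ => h0 i)

/-- Just to the right of `y`, no sample point is met. -/
theorem exists_gap {N : ℕ} (x : Fin N → ℝ) (y : ℝ) :
    ∃ z, y < z ∧ ∀ i, y < x i → z < x i := by
  have h : ∀ᶠ z in nhdsWithin y (Ioi y), ∀ i, y < x i → z < x i := by
    rw [Filter.eventually_all]
    intro i
    by_cases hi : y < x i
    · exact Filter.Eventually.filter_mono nhdsWithin_le_nhds
        ((gt_mem_nhds hi).mono fun z hz _ => hz)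
    · exact Filter.Eventually.of_forall fun z hz => absurd hz hi
  obtain ⟨z, hz, hz'⟩ := (h.and self_mem_nhdsWithin).exists
  exact ⟨z, hz', hz⟩

theorem lowerMedian_le_iff {N : ℕ} {lam : Fin N → ℝ} (hlam : lam ∈ stdSimplex ℝ (Fin N))
    (x : Fin N → ℝ) (y : ℝ) :
    lowerMedian lam x ≤ y ↔ 1 / 2 ≤ ∑ i with x i ≤ y, lam i := by
  obtain ⟨a, ha⟩ := (Set.finite_range x).bddBelow
  obtain ⟨b, hb⟩ := (Set.finite_range x).bddAbove
  have hne : {y : ℝ | 1 / 2 ≤ ∑ i with x i ≤ y, lam i}.Nonempty := by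
    refine ⟨b, ?_⟩
    have : ∑ i with x i ≤ b, lam i = ∑ i, lam i := by
      rw [Finset.filter_true_of_mem fun i _ => hb ⟨i, rfl⟩]
    rw [mem_ofPred_eq, this, hlam.2]; norm_num
  have hbdd : BddBelow {y : ℝ | 1 / 2 ≤ ∑ i with x i ≤ y, lam i} := by
    refine ⟨a, fun y hy => le_of_not_gt fun h => ?_⟩
    have : ∑ i with x i ≤ y, lam i = 0 := by
      rw [Finset.filter_false_of_mem fun i _ => not_le.2 (lt_of_lt_of_le h (ha ⟨i, rfl⟩))]
      simp
    rw [mem_ofPred_eq, this] at hy; norm_num at hy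
  refine ⟨fun h => ?_, fun h => csInf_le hbdd h⟩
  obtain ⟨z, hyz, hz⟩ := exists_gap x y
  obtain ⟨w, hw, hwz⟩ := exists_lt_of_csInf_lt hne (lt_of_le_of_lt h hyz)
  refine le_trans hw (sum_filter_mono hlam.1 fun i hi => ?_)
  by_contra hcon
  exact absurd (hz i (not_le.1 hcon)) (not_lt.2 (hi.trans hwz.le))

theorem upperMedian_le_iff {N : ℕ} {lam : Fin N → ℝ} (hlam : lam ∈ stdSimplex ℝ (Fin N))
    (x : Fin N → ℝ) (y : ℝ) :
    upperMedian lam x ≤ y ↔ 1 / 2 < ∑ i with x i ≤ y, lam i := by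
  obtain ⟨a, ha⟩ := (Set.finite_range x).bddBelow
  obtain ⟨b, hb⟩ := (Set.finite_range x).bddAbove
  have hne : {y : ℝ | ∑ i with x i < y, lam i ≤ 1 / 2}.Nonempty := by
    refine ⟨a, ?_⟩
    have : ∑ i with x i < a, lam i = 0 := by
      rw [Finset.filter_false_of_mem fun i _ => not_lt.2 (ha ⟨i, rfl⟩)]
      simp
    rw [mem_ofPred_eq, this]; norm_num
  have hbdd : BddAbove {y : ℝ | ∑ i with x i < y, lam i ≤ 1 / 2} := by
    refine ⟨b, fun y hy => le_of_not_gt fun h => ?_⟩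
    have : ∑ i with x i < y, lam i = ∑ i, lam i := by
      rw [Finset.filter_true_of_mem fun i _ => lt_of_le_of_lt (hb ⟨i, rfl⟩) h]
    rw [mem_ofPred_eq, this, hlam.2] at hy; norm_num at hy
  constructor
  · intro h
    obtain ⟨z, hyz, hz⟩ := exists_gap x y
    have h1 : 1 / 2 < ∑ i with x i < z, lam i := by
      by_contra hcon
      exact absurd (le_csSup hbdd (not_lt.1 hcon)) (not_le.2 (lt_of_le_of_lt h hyz))
    refine lt_of_lt_of_le h1 (sum_filter_mono hlam.1 fun i hi => ?_)
    by_contra hcon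
    exact absurd (hz i (not_le.1 hcon)) (not_lt.2 hi.le)
  · intro h
    refine csSup_le hne fun w hw => le_of_not_gt fun hyw => ?_
    exact absurd (h.trans_le (sum_filter_mono hlam.1 fun i hi => lt_of_le_of_lt hi hyw))
      (not_lt.2 hw)

/-- Just to the left of `t`, the set of indices `i` with `Q_{ν_i} ≤ x` is the same as at `t`. -/
theorem exists_left {N : ℕ} (ν : Fin N → Measure ℝ) {t : ℝ} (ht : t ∈ Ioo (0 : ℝ) 1) (x : ℝ) :
    ∃ s ∈ Ioo (0 : ℝ) t, ∀ i, quantile (ν i) s ≤ x → quantile (ν i) t ≤ x := by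
  have h : ∀ᶠ s in nhdsWithin t (Iio t), ∀ i, s ≤ cdf (ν i) x → t ≤ cdf (ν i) x := by
    rw [Filter.eventually_all]
    intro i
    by_cases hi : t ≤ cdf (ν i) x
    · exact Filter.Eventually.of_forall fun _ _ => hi
    · exact Filter.Eventually.filter_mono nhdsWithin_le_nhds
        ((lt_mem_nhds (not_le.1 hi)).mono fun s hs hs' => absurd hs' (not_le.2 hs))
  obtain ⟨s, ⟨hs, hst⟩, hs0⟩ := ((h.and self_mem_nhdsWithin).and
    (nhdsWithin_le_nhds (lt_mem_nhds ht.1))).exists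
  refine ⟨s, ⟨hs0, hst⟩, fun i hi => ?_⟩
  rw [quantile_le_iff (ν i) ⟨hs0, lt_trans hst ht.2⟩] at hi
  rw [quantile_le_iff (ν i) ht]
  exact hs i hi

theorem quantile_mono (ν : Measure ℝ) : MonotoneOn (quantile ν) (Ioo 0 1) := by
  intro s hs t ht hst
  rw [quantile_le_iff ν hs]
  exact hst.trans ((quantile_le_iff ν ht _).1 le_rfl)

theorem medianQuantile_mono {N : ℕ} {lam : Fin N → ℝ} (hlam : lam ∈ stdSimplex ℝ (Fin N))
    (ν : Fin N → Measure ℝ) {θ : ℝ} (hθ : θ ∈ Icc (0 : ℝ) 1) :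
    MonotoneOn (medianQuantile lam ν θ) (Ioo 0 1) := by
  intro s hs t ht hst
  refine add_le_add (mul_le_mul_of_nonneg_left ?_ (sub_nonneg.2 hθ.2))
    (mul_le_mul_of_nonneg_left ?_ hθ.1)
  · rw [lowerMedian_le_iff hlam]
    exact ((lowerMedian_le_iff hlam _ _).1 le_rfl).trans
      (sum_filter_mono hlam.1 fun i hi => (quantile_mono (ν i) hs ht hst).trans hi)
  · rw [upperMedian_le_iff hlam]
    exact ((upperMedian_le_iff hlam _ _).1 le_rfl).trans_le
      (sum_filter_mono hlam.1 fun i hi => (quantile_mono (ν i) hs ht hst).trans hi)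

/-- Left-continuity of `Q_θ`. -/
theorem exists_lt_medianQuantile {N : ℕ} {lam : Fin N → ℝ} (hlam : lam ∈ stdSimplex ℝ (Fin N))
    (ν : Fin N → Measure ℝ) {θ : ℝ} (hθ : θ ∈ Icc (0 : ℝ) 1) {t : ℝ} (ht : t ∈ Ioo (0 : ℝ) 1)
    {x : ℝ} (hx : x < medianQuantile lam ν θ t) :
    ∃ s ∈ Ioo (0 : ℝ) t, x < medianQuantile lam ν θ s := by
  set A := lowerMedian lam (fun i => quantile (ν i) t) with hA
  set B := upperMedian lam (fun i => quantile (ν i) t) with hB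
  have hx' : x < (1 - θ) * A + θ * B := hx
  obtain ⟨δ, hδ, hδx⟩ : ∃ δ, 0 < δ ∧ x < (1 - θ) * (A - δ) + θ * (B - δ) :=
    ⟨((1 - θ) * A + θ * B - x) / 2, by linarith, by ring_nf; linarith⟩
  obtain ⟨s₁, hs₁, h₁⟩ := exists_left ν ht (A - δ)
  obtain ⟨s₂, hs₂, h₂⟩ := exists_left ν ht (B - δ)
  have hA1 : A - δ < lowerMedian lam (fun i => quantile (ν i) s₁) := by
    by_contra hcon
    have := (lowerMedian_le_iff hlam _ _).2 (((lowerMedian_le_iff hlam _ _).1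
      (not_lt.1 hcon)).trans (sum_filter_mono hlam.1 h₁))
    linarith
  have hB1 : B - δ < upperMedian lam (fun i => quantile (ν i) s₂) := by
    by_contra hcon
    have := (upperMedian_le_iff hlam _ _).2 (((upperMedian_le_iff hlam _ _).1
      (not_lt.1 hcon)).trans_le (sum_filter_mono hlam.1 h₂))
    linarith
  have m₁ : s₁ ∈ Ioo (0 : ℝ) 1 := ⟨hs₁.1, hs₁.2.trans ht.2⟩
  have m₂ : s₂ ∈ Ioo (0 : ℝ) 1 := ⟨hs₂.1, hs₂.2.trans ht.2⟩
  have m : max s₁ s₂ ∈ Ioo (0 : ℝ) 1 := ⟨lt_max_of_lt_left m₁.1, max_lt m₁.2 m₂.2⟩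
  refine ⟨max s₁ s₂, ⟨m.1, max_lt hs₁.2 hs₂.2⟩, hδx.trans_le ?_⟩
  refine add_le_add (mul_le_mul_of_nonneg_left ?_ (sub_nonneg.2 hθ.2))
    (mul_le_mul_of_nonneg_left ?_ hθ.1)
  · have := medianQuantile_mono hlam ν (θ := 0) ⟨le_rfl, zero_le_one⟩ m₁ m (le_max_left _ _)
    simp only [medianQuantile, sub_zero, one_mul, zero_mul, add_zero] at this
    exact hA1.le.trans this
  · have := medianQuantile_mono hlam ν (θ := 1) ⟨zero_le_one, le_rfl⟩ m₂ m (le_max_right _ _)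
    simp only [medianQuantile, sub_self, one_mul, zero_mul, zero_add] at this
    exact hB1.le.trans this

theorem aemeasurable_medianQuantile {N : ℕ} {lam : Fin N → ℝ}
    (hlam : lam ∈ stdSimplex ℝ (Fin N)) (ν : Fin N → Measure ℝ) {θ : ℝ}
    (hθ : θ ∈ Icc (0 : ℝ) 1) :
    AEMeasurable (medianQuantile lam ν θ) (volume.restrict (Ioo (0 : ℝ) 1)) :=
  aemeasurable_restrict_of_monotoneOn measurableSet_Ioo (medianQuantile_mono hlam ν hθ)

/-- The horizontal median selection is a probability measure. -/
theorem isProbabilityMeasure_hMed {N : ℕ} {lam : Fin N → ℝ}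
    (hlam : lam ∈ stdSimplex ℝ (Fin N)) (ν : Fin N → Measure ℝ) {θ : ℝ}
    (hθ : θ ∈ Icc (0 : ℝ) 1) : IsProbabilityMeasure (hMed lam ν θ) := by
  have : IsProbabilityMeasure (volume.restrict (Ioo (0 : ℝ) 1)) := ⟨by simp⟩
  exact Measure.isProbabilityMeasure_map (aemeasurable_medianQuantile hlam ν hθ)

/-- The quantile function of the horizontal median selection is `Q_θ`. -/
theorem quantile_hMed {N : ℕ} {lam : Fin N → ℝ}
    (hlam : lam ∈ stdSimplex ℝ (Fin N)) (ν : Fin N → Measure ℝ) {θ : ℝ}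
    (hθ : θ ∈ Icc (0 : ℝ) 1) {t : ℝ} (ht : t ∈ Ioo (0 : ℝ) 1) :
    quantile (hMed lam ν θ) t = medianQuantile lam ν θ t := by
  have := isProbabilityMeasure_hMed hlam ν hθ
  have key : ∀ x, t ≤ cdf (hMed lam ν θ) x ↔ medianQuantile lam ν θ t ≤ x := by
    intro x
    have hcdf : ENNReal.ofReal (cdf (hMed lam ν θ) x)
        = volume (medianQuantile lam ν θ ⁻¹' Iic x ∩ Ioo 0 1) := by
      rw [ofReal_cdf, hMed, Measure.map_apply_of_aemeasurable
        (aemeasurable_medianQuantile hlam ν hθ) measurableSet_Iic,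
        Measure.restrict_apply₀' measurableSet_Ioo.nullMeasurableSet]
    constructor
    · intro h
      by_contra hcon
      obtain ⟨s, hs, hsx⟩ := exists_lt_medianQuantile hlam ν hθ ht (not_le.1 hcon)
      have hsub : medianQuantile lam ν θ ⁻¹' Iic x ∩ Ioo 0 1 ⊆ Ioo 0 s := by
        rintro u ⟨hu, hu01⟩
        refine ⟨hu01.1, lt_of_not_ge fun hsu => ?_⟩
        have := medianQuantile_mono hlam ν hθ ⟨hs.1, hs.2.trans ht.2⟩ hu01 hsu
        exact absurd (hsx.trans_le this) (not_lt.2 hu)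
      have h2 := measure_mono (μ := (volume : Measure ℝ)) hsub
      rw [← hcdf, Real.volume_Ioo, sub_zero, ENNReal.ofReal_le_ofReal_iff hs.1.le] at h2
      exact absurd (h.trans h2) (not_le.2 hs.2)
    · intro h
      have hsub : Ioo 0 t ⊆ medianQuantile lam ν θ ⁻¹' Iic x ∩ Ioo 0 1 := by
        intro u hu
        have hu01 : u ∈ Ioo (0 : ℝ) 1 := ⟨hu.1, hu.2.trans ht.2⟩
        exact ⟨(medianQuantile_mono hlam ν hθ hu01 ht hu.2.le).trans h, hu01⟩
      have h2 := measure_mono (μ := (volume : Measure ℝ)) hsub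
      rwa [← hcdf, Real.volume_Ioo, sub_zero, ENNReal.ofReal_le_ofReal_iff (cdf_nonneg _ _)] at h2
  exact le_antisymm ((quantile_le_iff _ ht _).2 ((key _).2 le_rfl))
    ((key _).1 ((quantile_le_iff _ ht _).1 le_rfl))

end HorizontalMedian

namespace HorizontalMedian

/-! ### Comparison of measures on the line through half-open intervals -/

/-! For `θ = 0` and `θ = 1`, the distribution function `F` of the median satisfies `t ≤ F x` exactly
when the weight of the indices `i` with `t ≤ F_i x` reaches (resp. exceeds) `1/2`. Thus `F x` is a
function of the numbers `F_i x` that is nondecreasing and commutes with adding a common constant. A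
bound on the increments of all `F_i` over `(a, b]`, from above or from below, therefore passes to
`F` (`IsThresholdMeasure.cdf_le_add`). Taking as bounds the masses under `max f_i` and `min f_i`,
and going from half-open intervals to Borel sets (`measure_le_of_Ioc_le`), gives absolute continuity
and the two-sided bound.

For intermediate `θ`, `Q_θ` is a convex combination of the monotone functions `Q_0` and `Q_1`. The
image of Lebesgue measure by a monotone `Q` is absolutely continuous iff `Q' > 0` a.e., a condition
stable under convex combinations. Its density `g` satisfies `g (Q t) = 1 / Q' t`, so that `∫ g ^ p`
is the integral of `(Q') ^ (-(p - 1))` over `(0,1)`. Convexity of `a ↦ a ^ (-(p - 1))` bounds it by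
the corresponding combination of the integrals for `θ = 0` and `θ = 1`, both controlled by `max
f_i`. For `p = ∞` the same scheme uses that the inverse of a convex combination is at most the
larger inverse. -/

theorem le_stieltjesFunction_measure {μ : Measure ℝ} {F : StieltjesFunction ℝ}
    (h : ∀ a b, a < b → μ (Ioc a b) ≤ ENNReal.ofReal (F b - F a)) : μ ≤ F.measure := by
  rw [← Measure.toOuterMeasure_le, StieltjesFunction.measure]
  -- The Stieltjes outer measure is the largest one below `F.length`, so only comparison with
  -- `length` is needed.
  refine (OuterMeasure.le_ofFunction (m_empty := F.length_empty)).2 fun s => ?_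
  change μ s ≤ F.length s
  rw [StieltjesFunction.length_eq]
  refine le_iInf fun a => le_iInf fun b => le_iInf fun hs => ?_
  have hbot : (botSet : Set ℝ) = ∅ := by
    ext x; simp [botSet]
  rw [hbot, sdiff_empty] at hs
  refine (measure_mono hs).trans ?_
  rcases lt_or_ge a b with hab | hab
  · exact h a b hab
  · simp [Ioc_eq_empty_of_le hab]

theorem measureReal_Ioc_eq_cdf_sub (μ : Measure ℝ) [IsProbabilityMeasure μ] {a b : ℝ}
    (hab : a ≤ b) : μ.real (Ioc a b) = cdf μ b - cdf μ a := by
  rw [measureReal_def]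
  nth_rw 1 [← measure_cdf μ]
  rw [StieltjesFunction.measure_Ioc, ENNReal.toReal_ofReal (sub_nonneg.2 (monotone_cdf μ hab))]

/-- Once normalised, a nonzero `ν` is a multiple of the Stieltjes measure of a cdf, and the previous
comparison applies. Nothing is asked of `μ`. -/
theorem measure_le_of_Ioc_le {μ ν : Measure ℝ} [IsFiniteMeasure ν]
    (h : ∀ a b, a < b → μ (Ioc a b) ≤ ν (Ioc a b)) : μ ≤ ν := by
  rcases eq_or_ne ν 0 with rfl | hν
  · have := le_stieltjesFunction_measure (μ := μ) (F := 0) (fun a b hab => by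
      simpa using h a b hab)
    simpa using this
  have h0 : ν univ ≠ 0 := by simpa using hν
  set c : NNReal := (ν univ).toNNReal with hc
  have hcν : (c : ℝ≥0∞) = ν univ := ENNReal.coe_toNNReal (measure_ne_top _ _)
  set P : Measure ℝ := (ν univ)⁻¹ • ν with hP
  have : IsProbabilityMeasure P := ⟨by
    simp [hP, ENNReal.inv_mul_cancel h0 (measure_ne_top _ _)]⟩
  have hνP : ν = (c • cdf P).measure := by
    rw [StieltjesFunction.measure_smul, measure_cdf, hP]
    change ν = (c : ℝ≥0∞) • (ν univ)⁻¹ • ν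
    rw [hcν, smul_smul,
      ENNReal.mul_inv_cancel h0 (measure_ne_top _ _), one_smul]
  rw [hνP]
  refine le_stieltjesFunction_measure fun a b hab => (h a b hab).trans_eq ?_
  conv_lhs => rw [hνP]
  rw [StieltjesFunction.measure_Ioc]

/-! ### Thresholds determined by an upward closed family of sets -/

/-- If `G` and `G'` are the thresholds of the levels `t` at which the superlevel sets of `F`,
respectively of `F'`, belong to an upward closed family `W`, then a uniform bound for `F' - F`
bounds `G' - G` too. -/
theorem threshold_le_add {ι : Type*} {W : Set ι → Prop} (hW : ∀ s t, s ⊆ t → W s → W t)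
    {F F' : ι → ℝ} {G G' m : ℝ} (hG : ∀ t, G < t → ¬ W {i | t ≤ F i})
    (hG' : ∀ t, t < G' → W {i | t ≤ F' i}) (h : ∀ i, F' i ≤ F i + m) : G' ≤ G + m := by
  by_contra! hlt
  obtain ⟨t, ht, ht'⟩ := exists_between hlt
  -- With `G + m < t < G'`, the set `{t ≤ F'}` is in `W` and lies inside `{t - m ≤ F}`, although `t
  -- - m > G`.
  refine hG (t - m) (by linarith) (hW _ _ (fun i hi => ?_) (hG' t ht'))
  have : t ≤ F' i := hi
  have := h i
  show t - m ≤ F i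
  linarith

/-- Quantiles give information at levels in `(0,1)` only, while a shift by `m` may leave this
interval. Outside `[0,1]` the superlevel sets are `univ` or `∅`. -/
theorem threshold_of_forall_Ioo {ι : Type*} {W : Set ι → Prop} (hW : ∀ s t, s ⊆ t → W s → W t)
    (huniv : W univ) (hempty : ¬ W ∅) {F : ι → ℝ} (hF : ∀ i, F i ∈ Icc (0 : ℝ) 1) {G : ℝ}
    (hG01 : G ∈ Icc (0 : ℝ) 1) (hG : ∀ t ∈ Ioo (0 : ℝ) 1, t ≤ G ↔ W {i | t ≤ F i}) :
    (∀ t, G < t → ¬ W {i | t ≤ F i}) ∧ ∀ t, t < G → W {i | t ≤ F i} := by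
  refine ⟨fun t ht hWt => ?_, fun t ht => ?_⟩
  · rcases lt_or_ge 1 t with h1 | h1
    · refine hempty (hW _ _ (fun i hi => ?_) hWt)
      exact absurd (le_trans hi (hF i).2) (not_le.2 h1)
    -- The level `t = 1` is not covered by `hG`; a smaller level `s > G` is.
    · obtain ⟨s, hs, hs'⟩ := exists_between ht
      have := (hG s ⟨hG01.1.trans_lt hs, hs'.trans_le h1⟩).2
        (hW _ _ (fun i hi => hs'.le.trans hi) hWt)
      linarith
  · rcases le_or_gt t 0 with h0 | h0
    · exact hW _ _ (fun i _ => h0.trans (hF i).1) huniv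
    · exact (hG t ⟨h0, ht.trans_le hG01.2⟩).1 ht.le

/-- The distribution function of `μ` is the threshold of an upward closed family for the distribution
functions of the `ν i`. -/
structure IsThresholdMeasure {N : ℕ} (ν : Fin N → Measure ℝ) (μ : Measure ℝ)
    (W : Set (Fin N) → Prop) : Prop where
  mono : ∀ s t, s ⊆ t → W s → W t
  univ : W univ
  empty : ¬ W ∅
  le_cdf_iff : ∀ x, ∀ t ∈ Ioo (0 : ℝ) 1, t ≤ cdf μ x ↔ W {i | t ≤ cdf (ν i) x}

namespace IsThresholdMeasure

variable {N : ℕ} {ν : Fin N → Measure ℝ} {μ : Measure ℝ} {W : Set (Fin N) → Prop}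

/-- Neither the order of `a` and `b` nor the sign of `m` matters, so this one inequality serves for
both the upper and the lower bound. -/
theorem cdf_le_add (h : IsThresholdMeasure ν μ W) {a b m : ℝ}
    (hm : ∀ i, cdf (ν i) b ≤ cdf (ν i) a + m) : cdf μ b ≤ cdf μ a + m := by
  have key := fun x => threshold_of_forall_Ioo h.mono h.univ h.empty
    (fun i => ⟨cdf_nonneg (ν i) x, cdf_le_one (ν i) x⟩) ⟨cdf_nonneg μ x, cdf_le_one μ x⟩
    (h.le_cdf_iff x)
  exact threshold_le_add h.mono (key a).1 (key b).2 hm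

theorem le_of_forall_le (h : IsThresholdMeasure ν μ W) [∀ i, IsProbabilityMeasure (ν i)]
    [IsProbabilityMeasure μ] {σ : Measure ℝ} [IsFiniteMeasure σ] (hσ : ∀ i, ν i ≤ σ) : μ ≤ σ := by
  refine measure_le_of_Ioc_le fun a b hab => ?_
  rw [← ENNReal.toReal_le_toReal (measure_ne_top _ _) (measure_ne_top _ _)]
  change μ.real _ ≤ σ.real _
  rw [measureReal_Ioc_eq_cdf_sub μ hab.le]
  have := h.cdf_le_add (a := a) (b := b) (m := σ.real (Ioc a b)) fun i => by
    rw [← sub_le_iff_le_add', ← measureReal_Ioc_eq_cdf_sub (ν i) hab.le]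
    exact ENNReal.toReal_mono (measure_ne_top _ _) (hσ i _)
  linarith

theorem ge_of_forall_ge (h : IsThresholdMeasure ν μ W) [∀ i, IsProbabilityMeasure (ν i)]
    [IsProbabilityMeasure μ] {τ : Measure ℝ} [IsFiniteMeasure τ] (hτ : ∀ i, τ ≤ ν i) : τ ≤ μ := by
  refine measure_le_of_Ioc_le fun a b hab => ?_
  rw [← ENNReal.toReal_le_toReal (measure_ne_top _ _) (measure_ne_top _ _)]
  change τ.real _ ≤ μ.real _
  rw [measureReal_Ioc_eq_cdf_sub μ hab.le]
  -- Exchanging the endpoints and taking `m` negative turns the upper estimate into a lower one.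
  have := h.cdf_le_add (a := b) (b := a) (m := -τ.real (Ioc a b)) fun i => by
    have : τ.real (Ioc a b) ≤ cdf (ν i) b - cdf (ν i) a := by
      rw [← measureReal_Ioc_eq_cdf_sub (ν i) hab.le]
      exact ENNReal.toReal_mono (measure_ne_top _ _) (hτ i _)
    linarith
  linarith

end IsThresholdMeasure

theorem sum_indicator_mono {N : ℕ} {lam : Fin N → ℝ} (h0 : ∀ i, 0 ≤ lam i)
    {s t : Set (Fin N)} (hst : s ⊆ t) : ∑ i, s.indicator lam i ≤ ∑ i, t.indicator lam i :=
  Finset.sum_le_sum fun i _ => indicator_le_indicator_of_subset hst h0 i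

theorem sum_filter_quantile_le {N : ℕ} (lam : Fin N → ℝ) (ν : Fin N → Measure ℝ) (x : ℝ) {t : ℝ}
    (ht : t ∈ Ioo (0 : ℝ) 1) :
    ∑ i with quantile (ν i) t ≤ x, lam i = ∑ i, {i | t ≤ cdf (ν i) x}.indicator lam i := by
  rw [Finset.sum_filter]
  refine Finset.sum_congr rfl fun i _ => ?_
  simp only [indicator_apply, mem_ofPred_eq, quantile_le_iff (ν i) ht]

/-- Galois connections chain together: `t ≤ F x` iff `Q t ≤ x`, iff the indices with `Q_i t ≤ x`,
i.e. `t ≤ F_i x`, carry at least half the weight. -/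
theorem isThresholdMeasure_hMed_zero {N : ℕ} {lam : Fin N → ℝ}
    (hlam : lam ∈ stdSimplex ℝ (Fin N)) (ν : Fin N → Measure ℝ) :
    IsThresholdMeasure ν (hMed lam ν 0) (fun s => 1 / 2 ≤ ∑ i, s.indicator lam i) where
  mono s t hst h := h.trans (sum_indicator_mono hlam.1 hst)
  univ := by simp only [indicator_univ, hlam.2]; norm_num
  empty := by simp
  le_cdf_iff x t ht := by
    rw [← quantile_le_iff _ ht, quantile_hMed hlam ν ⟨le_rfl, zero_le_one⟩ ht,
      ← sum_filter_quantile_le lam ν x ht, ← lowerMedian_le_iff hlam]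
    simp [medianQuantile]

theorem isThresholdMeasure_hMed_one {N : ℕ} {lam : Fin N → ℝ}
    (hlam : lam ∈ stdSimplex ℝ (Fin N)) (ν : Fin N → Measure ℝ) :
    IsThresholdMeasure ν (hMed lam ν 1) (fun s => 1 / 2 < ∑ i, s.indicator lam i) where
  mono s t hst h := h.trans_le (sum_indicator_mono hlam.1 hst)
  univ := by simp only [indicator_univ, hlam.2]; norm_num
  empty := by simp
  le_cdf_iff x t ht := by
    rw [← quantile_le_iff _ ht, quantile_hMed hlam ν ⟨zero_le_one, le_rfl⟩ ht,
      ← sum_filter_quantile_le lam ν x ht, ← upperMedian_le_iff hlam]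
    simp [medianQuantile]

/-! ### Images of Lebesgue measure by a monotone function -/

section Monotone

variable {I : Set ℝ} {Q : ℝ → ℝ}

theorem ae_differentiableAt_of_monotoneOn (hI : IsOpen I) (hQ : MonotoneOn Q I) :
    ∀ᵐ t ∂volume.restrict I, DifferentiableAt ℝ Q t := by
  filter_upwards [hQ.ae_differentiableWithinAt hI.measurableSet,
    ae_restrict_mem hI.measurableSet] with t ht hmem
  exact ht.differentiableAt (hI.mem_nhds hmem)

theorem deriv_nonneg_of_monotoneOn (hI : IsOpen I) (hQ : MonotoneOn Q I) {t : ℝ} (ht : t ∈ I) :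
    0 ≤ deriv Q t := by
  rw [← derivWithin_of_isOpen hI ht]
  exact hQ.derivWithin_nonneg

/-- Injectivity is not needed: a monotone function takes at most countably many values more than
once. -/
theorem setLIntegral_image_of_monotoneOn (hQ : MonotoneOn Q I) {s : Set ℝ}
    (hs : MeasurableSet s) (hsI : s ⊆ I) (hd : ∀ t ∈ s, DifferentiableAt ℝ Q t) (u : ℝ → ℝ≥0∞) :
    ∫⁻ x in Q '' s, u x = ∫⁻ t in s, ENNReal.ofReal (deriv Q t) * u (Q t) :=
  lintegral_image_eq_lintegral_deriv_mul_of_monotoneOn hs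
    (fun t ht => (hd t ht).hasDerivAt.hasDerivWithinAt) (hQ.mono hsI) u

theorem measurableSet_inter_differentiableAt (hI : IsOpen I) (Q : ℝ → ℝ) :
    MeasurableSet (I ∩ {t | DifferentiableAt ℝ Q t}) :=
  hI.measurableSet.inter (measurableSet_of_differentiableAt ℝ Q)

theorem restrict_inter_differentiableAt (hI : IsOpen I) (hQ : MonotoneOn Q I) :
    volume.restrict (I ∩ {t | DifferentiableAt ℝ Q t}) = volume.restrict I := by
  refine Measure.restrict_congr_set (Filter.eventuallyEq_set.2 ?_)
  filter_upwards [(ae_restrict_iff' hI.measurableSet).1 (ae_differentiableAt_of_monotoneOn hI hQ)]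
    with t ht
  exact ⟨fun h => h.1, fun h => ⟨h, ht h⟩⟩

/-- If `s` is null, the change of variables gives zero integral to `Q'` over the preimage of `s`; as
`Q' > 0` a.e., this preimage is null. -/
theorem map_absolutelyContinuous_of_deriv_pos (hI : IsOpen I) (hQ : MonotoneOn Q I)
    (hpos : ∀ᵐ t ∂volume.restrict I, 0 < deriv Q t) :
    Measure.map Q (volume.restrict I) ≪ volume := by
  have hQm : AEMeasurable Q (volume.restrict I) :=
    aemeasurable_restrict_of_monotoneOn hI.measurableSet hQ
  refine Measure.AbsolutelyContinuous.mk fun s hs h0 => ?_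
  have hD := measurableSet_inter_differentiableAt hI Q
  have h1 := setLIntegral_image_of_monotoneOn hQ hD inter_subset_left (fun t ht => ht.2)
    (s.indicator 1)
  have h2 : ∫⁻ x in Q '' (I ∩ {t | DifferentiableAt ℝ Q t}), s.indicator 1 x = 0 := by
    rw [lintegral_indicator_one hs]
    exact Measure.restrict_le_self.absolutelyContinuous h0
  rw [h2, restrict_inter_differentiableAt hI hQ, eq_comm, lintegral_eq_zero_iff'] at h1
  · rw [Measure.map_apply_of_aemeasurable hQm hs]
    refine measure_eq_zero_iff_ae_notMem.2 ?_
    filter_upwards [h1, hpos] with t ht hpt hts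
    have : s.indicator (1 : ℝ → ℝ≥0∞) (Q t) = 1 := by
      rw [indicator_of_mem (show Q t ∈ s from hts), Pi.one_apply]
    simp only [this, mul_one, Pi.zero_apply, ENNReal.ofReal_eq_zero] at ht
    linarith
  · exact (measurable_deriv Q).ennreal_ofReal.aemeasurable.mul
      ((measurable_one.indicator hs).comp_aemeasurable hQm)

/-- The critical set `Z` has a null image, by the change of variables; absolute continuity then
makes `Z` itself null. -/
theorem deriv_pos_of_map_absolutelyContinuous (hI : IsOpen I) (hQ : MonotoneOn Q I)
    (hac : Measure.map Q (volume.restrict I) ≪ volume) :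
    ∀ᵐ t ∂volume.restrict I, 0 < deriv Q t := by
  have hQm : AEMeasurable Q (volume.restrict I) :=
    aemeasurable_restrict_of_monotoneOn hI.measurableSet hQ
  set Z := I ∩ {t | DifferentiableAt ℝ Q t} ∩ {t | deriv Q t = 0} with hZ
  have hZm : MeasurableSet Z := (measurableSet_inter_differentiableAt hI Q).inter
    (measurable_deriv Q (measurableSet_singleton 0))
  have h1 : volume (Q '' Z) = 0 := by
    have := setLIntegral_image_of_monotoneOn hQ hZm (fun t ht => ht.1.1)
      (fun t ht => ht.1.2) 1
    simp only [Pi.one_apply, setLIntegral_one, mul_one] at this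
    rw [this, setLIntegral_congr_fun hZm (g := 0) fun t ht => by simp [show deriv Q t = 0 from ht.2]]
    simp
  have h2 := measure_eq_zero_iff_ae_notMem.1 (Measure.preimage_null_of_map_null hQm (hac h1))
  filter_upwards [h2, ae_differentiableAt_of_monotoneOn hI hQ,
    ae_restrict_mem hI.measurableSet] with t ht htd htI
  refine (deriv_nonneg_of_monotoneOn hI hQ htI).lt_of_ne' fun h => ht ?_
  exact ⟨t, ⟨⟨htI, htd⟩, h⟩, rfl⟩

/-- A flat piece of `Q` would create an atom. -/
theorem injOn_of_map_absolutelyContinuous (hI : IsOpen I) (hI' : I.OrdConnected)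
    (hQ : MonotoneOn Q I) (hac : Measure.map Q (volume.restrict I) ≪ volume) : InjOn Q I := by
  have hQm : AEMeasurable Q (volume.restrict I) :=
    aemeasurable_restrict_of_monotoneOn hI.measurableSet hQ
  have key : ∀ s ∈ I, ∀ t ∈ I, Q s = Q t → ¬ s < t := by
    intro s hs t ht hst hlt
    have h0 := Measure.preimage_null_of_map_null hQm (hac (Real.volume_singleton (a := Q s)))
    have hsub : Ioo s t ⊆ Q ⁻¹' {Q s} ∩ I := fun u hu => by
      have huI : u ∈ I := hI'.out hs ht ⟨hu.1.le, hu.2.le⟩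
      exact ⟨le_antisymm ((hQ huI ht hu.2.le).trans hst.ge) (hQ hs huI hu.1.le), huI⟩
    rw [Measure.restrict_apply₀' hI.measurableSet.nullMeasurableSet] at h0
    have := measure_mono_null hsub h0
    rw [Real.volume_Ioo, ENNReal.ofReal_eq_zero] at this
    linarith
  intro s hs t ht hst
  rcases lt_trichotomy s t with h | h | h
  · exact absurd h (key s hs t ht hst)
  · exact h
  · exact absurd h (key t ht s hs hst.symm)

/-- The density of the image measure is the inverse of the derivative. -/
theorem density_comp_eq_inv_deriv (hI : IsOpen I) (hI' : I.OrdConnected)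
    (hQ : MonotoneOn Q I) {g : ℝ → ℝ≥0∞} (hg : Measurable g)
    (hmap : Measure.map Q (volume.restrict I) = volume.withDensity g) :
    ∀ᵐ t ∂volume.restrict I, 0 < deriv Q t ∧ g (Q t) = ENNReal.ofReal (deriv Q t)⁻¹ := by
  have hQm : AEMeasurable Q (volume.restrict I) :=
    aemeasurable_restrict_of_monotoneOn hI.measurableSet hQ
  have hac : Measure.map Q (volume.restrict I) ≪ volume :=
    hmap ▸ withDensity_absolutelyContinuous _ _
  have hinj := injOn_of_map_absolutelyContinuous hI hI' hQ hac
  have h1 : (fun t => ENNReal.ofReal (deriv Q t) * g (Q t)) =ᵐ[volume.restrict I] 1 := by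
    refine ae_eq_of_forall_setLIntegral_eq_of_sigmaFinite₀
      ((measurable_deriv Q).ennreal_ofReal.aemeasurable.mul (hg.comp_aemeasurable hQm))
      aemeasurable_const fun s hs _ => ?_
    have hE := (measurableSet_inter_differentiableAt hI Q).inter hs
    -- The integral over `s` becomes the mass that the image measure gives to `Q '' E`, with `E` the
    -- differentiability points in `I ∩ s`; by injectivity this is the length of `E`.
    rw [← restrict_inter_differentiableAt hI hQ, Measure.restrict_restrict hs, inter_comm s,
      ← setLIntegral_image_of_monotoneOn hQ hE (fun t ht => ht.1.1) (fun t ht => ht.1.2),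
      ← withDensity_apply _ (hE.image_of_monotoneOn (hQ.mono fun t ht => ht.1.1)), ← hmap,
      Measure.map_apply_of_aemeasurable hQm
        (hE.image_of_monotoneOn (hQ.mono fun t ht => ht.1.1)),
      Measure.restrict_apply₀' hI.measurableSet.nullMeasurableSet,
      hinj.preimage_image_inter fun t ht => ht.1.1]
    simp
  filter_upwards [h1, deriv_pos_of_map_absolutelyContinuous hI hQ hac] with t ht hpos
  refine ⟨hpos, ?_⟩
  rw [ENNReal.ofReal_inv_of_pos hpos]
  exact ENNReal.eq_inv_of_mul_eq_one_left (by rw [mul_comm]; exact ht)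

end Monotone

/-! ### Interpolation of quantile functions -/

/-- The function `a ↦ a ^ (-q)` is convex; the weighted AM-GM inequality is used twice, for `a, b`
and for their powers. -/
theorem inv_convexComb_rpow_le {θ a b q : ℝ} (hθ : θ ∈ Icc (0 : ℝ) 1) (ha : 0 < a) (hb : 0 < b)
    (hq : 0 ≤ q) :
    (((1 - θ) * a + θ * b)⁻¹) ^ q ≤ (1 - θ) * (a⁻¹) ^ q + θ * (b⁻¹) ^ q := by
  have h0 : 0 ≤ 1 - θ := sub_nonneg.2 hθ.2
  have h1 := Real.geom_mean_le_arith_mean2_weighted h0 hθ.1 ha.le hb.le (by ring)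
  have hg : 0 < a ^ (1 - θ) * b ^ θ := by positivity
  have h2 := Real.geom_mean_le_arith_mean2_weighted h0 hθ.1
    (Real.rpow_nonneg (inv_nonneg.2 ha.le) q) (Real.rpow_nonneg (inv_nonneg.2 hb.le) q) (by ring)
  refine le_trans ?_ h2
  calc (((1 - θ) * a + θ * b)⁻¹) ^ q ≤ ((a ^ (1 - θ) * b ^ θ)⁻¹) ^ q :=
        Real.rpow_le_rpow (inv_nonneg.2 (hg.le.trans h1)) (inv_anti₀ hg h1) hq
    _ = ((a⁻¹) ^ q) ^ (1 - θ) * ((b⁻¹) ^ q) ^ θ := by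
        rw [← Real.rpow_mul (inv_nonneg.2 ha.le), ← Real.rpow_mul (inv_nonneg.2 hb.le),
          mul_comm q, mul_comm q, Real.rpow_mul (inv_nonneg.2 ha.le),
          Real.rpow_mul (inv_nonneg.2 hb.le), mul_inv, Real.inv_rpow ha.le, Real.inv_rpow hb.le,
          Real.mul_rpow (by positivity) (by positivity)]

theorem inv_convexComb_le_max {θ a b : ℝ} (hθ : θ ∈ Icc (0 : ℝ) 1) (ha : 0 < a) (hb : 0 < b) :
    ((1 - θ) * a + θ * b)⁻¹ ≤ max a⁻¹ b⁻¹ := by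
  have := inv_convexComb_rpow_le hθ ha hb zero_le_one
  simp only [Real.rpow_one] at this
  refine this.trans ((add_le_add (mul_le_mul_of_nonneg_left (le_max_left _ b⁻¹)
    (sub_nonneg.2 hθ.2)) (mul_le_mul_of_nonneg_left (le_max_right a⁻¹ _) hθ.1)).trans_eq ?_)
  ring

/-- One factor `g` is absorbed into `μ`; the integral can then be pulled back by a map with image
measure `μ`. -/
theorem lintegral_density_rpow {μ : Measure ℝ} {g : ℝ → ℝ≥0∞} (hg : Measurable g)
    (hμ : μ = volume.withDensity g) {p : ℝ} (hp : 1 ≤ p) :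
    ∫⁻ x, g x ^ p = ∫⁻ x, g x ^ (p - 1) ∂μ := by
  rw [hμ, lintegral_withDensity_eq_lintegral_mul _ hg (hg.pow_const _)]
  refine lintegral_congr fun x => ?_
  simp only [Pi.mul_apply]
  conv_lhs => rw [show p = 1 + (p - 1) by ring]
  rw [ENNReal.rpow_add_of_nonneg _ _ zero_le_one (by linarith), ENNReal.rpow_one]

section Interpolation

variable {I : Set ℝ} {Q₀ Q₁ : ℝ → ℝ} {θ : ℝ}

theorem deriv_interpolation {t : ℝ} (h₀ : DifferentiableAt ℝ Q₀ t) (h₁ : DifferentiableAt ℝ Q₁ t) :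
    deriv (fun t => (1 - θ) * Q₀ t + θ * Q₁ t) t = (1 - θ) * deriv Q₀ t + θ * deriv Q₁ t :=
  ((h₀.hasDerivAt.const_mul (1 - θ)).add (h₁.hasDerivAt.const_mul θ)).deriv

theorem monotoneOn_interpolation (hθ : θ ∈ Icc (0 : ℝ) 1) (hQ₀ : MonotoneOn Q₀ I)
    (hQ₁ : MonotoneOn Q₁ I) : MonotoneOn (fun t => (1 - θ) * Q₀ t + θ * Q₁ t) I :=
  fun _ hs _ ht hst => add_le_add
    (mul_le_mul_of_nonneg_left (hQ₀ hs ht hst) (sub_nonneg.2 hθ.2))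
    (mul_le_mul_of_nonneg_left (hQ₁ hs ht hst) hθ.1)

theorem map_interpolation_absolutelyContinuous (hI : IsOpen I) (hθ : θ ∈ Icc (0 : ℝ) 1)
    (hQ₀ : MonotoneOn Q₀ I) (hQ₁ : MonotoneOn Q₁ I)
    (h₀ : Measure.map Q₀ (volume.restrict I) ≪ volume)
    (h₁ : Measure.map Q₁ (volume.restrict I) ≪ volume) :
    Measure.map (fun t => (1 - θ) * Q₀ t + θ * Q₁ t) (volume.restrict I) ≪ volume := by
  refine map_absolutelyContinuous_of_deriv_pos hI (monotoneOn_interpolation hθ hQ₀ hQ₁) ?_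
  filter_upwards [ae_differentiableAt_of_monotoneOn hI hQ₀,
    ae_differentiableAt_of_monotoneOn hI hQ₁, deriv_pos_of_map_absolutelyContinuous hI hQ₀ h₀,
    deriv_pos_of_map_absolutelyContinuous hI hQ₁ h₁] with t hd₀ hd₁ hp₀ hp₁
  rw [deriv_interpolation hd₀ hd₁]
  rcases hθ.1.eq_or_lt with rfl | h
  · simpa using hp₀
  · exact add_pos_of_nonneg_of_pos (mul_nonneg (sub_nonneg.2 hθ.2) hp₀.le) (mul_pos h hp₁)

variable {g₀ g₁ g : ℝ → ℝ≥0∞}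

/-- Here `a` and `b` are the derivatives of `Q₀` and `Q₁` at `t`. -/
theorem density_interpolation_comp (hI : IsOpen I) (hI' : I.OrdConnected)
    (hθ : θ ∈ Icc (0 : ℝ) 1) (hQ₀ : MonotoneOn Q₀ I) (hQ₁ : MonotoneOn Q₁ I)
    (hg₀ : Measurable g₀) (hg₁ : Measurable g₁) (hg : Measurable g)
    (h₀ : Measure.map Q₀ (volume.restrict I) = volume.withDensity g₀)
    (h₁ : Measure.map Q₁ (volume.restrict I) = volume.withDensity g₁)
    (h : Measure.map (fun t => (1 - θ) * Q₀ t + θ * Q₁ t) (volume.restrict I)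
      = volume.withDensity g) :
    ∀ᵐ t ∂volume.restrict I, ∃ a b : ℝ, 0 < a ∧ 0 < b ∧ g₀ (Q₀ t) = ENNReal.ofReal a⁻¹ ∧
      g₁ (Q₁ t) = ENNReal.ofReal b⁻¹ ∧
      g ((1 - θ) * Q₀ t + θ * Q₁ t) = ENNReal.ofReal ((1 - θ) * a + θ * b)⁻¹ := by
  filter_upwards [ae_differentiableAt_of_monotoneOn hI hQ₀,
    ae_differentiableAt_of_monotoneOn hI hQ₁, density_comp_eq_inv_deriv hI hI' hQ₀ hg₀ h₀,
    density_comp_eq_inv_deriv hI hI' hQ₁ hg₁ h₁,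
    density_comp_eq_inv_deriv hI hI' (monotoneOn_interpolation hθ hQ₀ hQ₁) hg h]
    with t hd₀ hd₁ hp₀ hp₁ hp
  refine ⟨deriv Q₀ t, deriv Q₁ t, hp₀.1, hp₁.1, hp₀.2, hp₁.2, ?_⟩
  rw [hp.2, deriv_interpolation hd₀ hd₁]

/-- Displacement convexity of `∫ g ^ p` along monotone rearrangements. -/
theorem lintegral_density_interpolation_rpow_le (hI : IsOpen I) (hI' : I.OrdConnected)
    (hθ : θ ∈ Icc (0 : ℝ) 1) (hQ₀ : MonotoneOn Q₀ I) (hQ₁ : MonotoneOn Q₁ I)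
    (hg₀ : Measurable g₀) (hg₁ : Measurable g₁) (hg : Measurable g)
    (h₀ : Measure.map Q₀ (volume.restrict I) = volume.withDensity g₀)
    (h₁ : Measure.map Q₁ (volume.restrict I) = volume.withDensity g₁)
    (h : Measure.map (fun t => (1 - θ) * Q₀ t + θ * Q₁ t) (volume.restrict I)
      = volume.withDensity g) {p : ℝ} (hp : 1 ≤ p) :
    ∫⁻ x, g x ^ p ≤ ENNReal.ofReal (1 - θ) * (∫⁻ x, g₀ x ^ p)
      + ENNReal.ofReal θ * ∫⁻ x, g₁ x ^ p := by
  have hm₀ := aemeasurable_restrict_of_monotoneOn (μ := volume) hI.measurableSet hQ₀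
  have hm₁ := aemeasurable_restrict_of_monotoneOn (μ := volume) hI.measurableSet hQ₁
  have hm := aemeasurable_restrict_of_monotoneOn (μ := volume) hI.measurableSet
    (monotoneOn_interpolation hθ hQ₀ hQ₁)
  rw [lintegral_density_rpow hg₀ h₀ hp, lintegral_density_rpow hg₁ h₁ hp,
    lintegral_density_rpow hg h hp, lintegral_map' (hg₀.pow_const _).aemeasurable hm₀,
    lintegral_map' (hg₁.pow_const _).aemeasurable hm₁,
    lintegral_map' (hg.pow_const _).aemeasurable hm,
    ← lintegral_const_mul' _ _ ENNReal.ofReal_ne_top,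
    ← lintegral_const_mul' _ _ ENNReal.ofReal_ne_top, ← lintegral_add_left' ?_]
  · refine lintegral_mono_ae ?_
    filter_upwards [density_interpolation_comp hI hI' hθ hQ₀ hQ₁ hg₀ hg₁ hg h₀ h₁ h]
      with t ⟨a, b, ha, hb, e₀, e₁, e⟩
    have hq : 0 ≤ p - 1 := sub_nonneg.2 hp
    have h1θ : 0 ≤ 1 - θ := sub_nonneg.2 hθ.2
    have hab : 0 ≤ (1 - θ) * a + θ * b :=
      add_nonneg (mul_nonneg h1θ ha.le) (mul_nonneg hθ.1 hb.le)
    rw [e₀, e₁, e, ENNReal.ofReal_rpow_of_nonneg (inv_nonneg.2 ha.le) hq,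
      ENNReal.ofReal_rpow_of_nonneg (inv_nonneg.2 hb.le) hq,
      ENNReal.ofReal_rpow_of_nonneg (inv_nonneg.2 hab) hq, ← ENNReal.ofReal_mul h1θ,
      ← ENNReal.ofReal_mul hθ.1, ← ENNReal.ofReal_add (by positivity)
        (mul_nonneg hθ.1 (by positivity))]
    exact ENNReal.ofReal_le_ofReal (inv_convexComb_rpow_le hθ ha hb hq)
  · exact ((hg₀.pow_const _).comp_aemeasurable hm₀).const_mul _

theorem density_interpolation_le_const (hI : IsOpen I) (hI' : I.OrdConnected)
    (hθ : θ ∈ Icc (0 : ℝ) 1) (hQ₀ : MonotoneOn Q₀ I) (hQ₁ : MonotoneOn Q₁ I)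
    (hg₀ : Measurable g₀) (hg₁ : Measurable g₁) (hg : Measurable g)
    (h₀ : Measure.map Q₀ (volume.restrict I) = volume.withDensity g₀)
    (h₁ : Measure.map Q₁ (volume.restrict I) = volume.withDensity g₁)
    (h : Measure.map (fun t => (1 - θ) * Q₀ t + θ * Q₁ t) (volume.restrict I)
      = volume.withDensity g) {C : ℝ≥0∞} (hC₀ : ∀ᵐ x, g₀ x ≤ C) (hC₁ : ∀ᵐ x, g₁ x ≤ C) :
    ∀ᵐ x, g x ≤ C := by
  have hm₀ := aemeasurable_restrict_of_monotoneOn (μ := volume) hI.measurableSet hQ₀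
  have hm₁ := aemeasurable_restrict_of_monotoneOn (μ := volume) hI.measurableSet hQ₁
  have hm := aemeasurable_restrict_of_monotoneOn (μ := volume) hI.measurableSet
    (monotoneOn_interpolation hθ hQ₀ hQ₁)
  have hac₀ : Measure.map Q₀ (volume.restrict I) ≪ volume :=
    h₀ ▸ withDensity_absolutelyContinuous _ _
  have hac₁ : Measure.map Q₁ (volume.restrict I) ≪ volume :=
    h₁ ▸ withDensity_absolutelyContinuous _ _
  have key : ∀ᵐ t ∂volume.restrict I, g ((1 - θ) * Q₀ t + θ * Q₁ t) ≤ C := by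
    filter_upwards [density_interpolation_comp hI hI' hθ hQ₀ hQ₁ hg₀ hg₁ hg h₀ h₁ h,
      ae_of_ae_map hm₀ (hac₀.ae_le hC₀), ae_of_ae_map hm₁ (hac₁.ae_le hC₁)]
      with t ⟨a, b, ha, hb, e₀, e₁, e⟩ hc₀ hc₁
    rw [e₀] at hc₀
    rw [e₁] at hc₁
    rw [e]
    refine (ENNReal.ofReal_le_ofReal (inv_convexComb_le_max hθ ha hb)).trans ?_
    rw [ENNReal.ofReal_max]
    exact max_le hc₀ hc₁
  -- Pushing `key` forward yields the bound only where `g ≠ 0`; elsewhere it is trivial.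
  have key' : ∀ᵐ x ∂volume.withDensity g, g x ≤ C := by
    rw [← h, ae_map_iff hm (measurableSet_le hg measurable_const)]
    exact key
  rw [ae_withDensity_iff hg] at key'
  filter_upwards [key'] with x hx
  by_cases h0 : g x = 0
  · simp [h0]
  · exact hx h0

end Interpolation

/-! ### Densities -/

section Envelope

variable {N : ℕ} {f : Fin N → ℝ → ℝ}

theorem le_iSup_apply (f : Fin N → ℝ → ℝ) (i : Fin N) (x : ℝ) : f i x ≤ ⨆ i, f i x :=
  le_ciSup (f := fun i => f i x) (finite_range _).bddAbove i

theorem iInf_apply_le (f : Fin N → ℝ → ℝ) (i : Fin N) (x : ℝ) : ⨅ i, f i x ≤ f i x :=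
  ciInf_le (f := fun i => f i x) (finite_range _).bddBelow i

theorem iSup_le_sum_of_nonneg {a : Fin N → ℝ} (ha : ∀ i, 0 ≤ a i) : ⨆ i, a i ≤ ∑ i, a i :=
  Real.iSup_le (fun i => Finset.single_le_sum (fun j _ => ha j) (Finset.mem_univ i))
    (Finset.sum_nonneg fun i _ => ha i)

theorem norm_iSup_le_norm_sum (hf : ∀ i, ∀ᵐ x ∂(volume : Measure ℝ), 0 ≤ f i x) :
    ∀ᵐ x ∂(volume : Measure ℝ), ‖⨆ i, f i x‖ ≤ ‖(∑ i, f i) x‖ := by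
  filter_upwards [ae_all_iff.2 hf] with x hx
  rw [Real.norm_of_nonneg (Real.iSup_nonneg hx), Finset.sum_apply]
  exact (iSup_le_sum_of_nonneg hx).trans (Real.le_norm_self _)

theorem integrable_iSup (hf : ∀ i, Integrable (f i) volume)
    (hf0 : ∀ i, ∀ᵐ x ∂(volume : Measure ℝ), 0 ≤ f i x) :
    Integrable (fun x => ⨆ i, f i x) volume :=
  (integrable_finsetSum' Finset.univ fun i _ => hf i).mono
    (AEMeasurable.iSup fun i => (hf i).aemeasurable).aestronglyMeasurable
    (norm_iSup_le_norm_sum hf0)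

theorem eLpNorm_iSup_le_sum (hf : ∀ i, AEStronglyMeasurable (f i) volume)
    (hf0 : ∀ i, ∀ᵐ x ∂(volume : Measure ℝ), 0 ≤ f i x) {p : ℝ≥0∞} (hp : 1 ≤ p) :
    eLpNorm (fun x => ⨆ i, f i x) p volume ≤ ∑ i, eLpNorm (f i) p volume :=
  (eLpNorm_mono_ae (norm_iSup_le_norm_sum hf0)).trans (eLpNorm_sum_le (fun i _ => hf i) hp)

end Envelope

theorem isDensity_toReal_rnDeriv {μ : Measure ℝ} [IsFiniteMeasure μ] (h : μ ≪ volume) :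
    IsDensity (fun x => (μ.rnDeriv volume x).toReal) μ where
  integrable := Measure.integrable_toReal_rnDeriv
  nonneg := ae_of_all _ fun _ => ENNReal.toReal_nonneg
  eq_withDensity := by
    conv_lhs => rw [← Measure.withDensity_rnDeriv_eq μ volume h]
    refine withDensity_congr_ae ?_
    filter_upwards [Measure.rnDeriv_lt_top μ volume] with x hx
    rw [ENNReal.ofReal_toReal hx.ne]

theorem rnDeriv_le_of_le_withDensity {μ : Measure ℝ} [IsFiniteMeasure μ] {u : ℝ → ℝ≥0∞}
    (h : μ ≤ volume.withDensity u) : ∀ᵐ x, μ.rnDeriv volume x ≤ u x := by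
  refine ae_le_of_forall_setLIntegral_le_of_sigmaFinite (Measure.measurable_rnDeriv _ _)
    fun s hs _ => ?_
  rw [← withDensity_apply _ hs, ← withDensity_apply _ hs]
  exact (Measure.withDensity_rnDeriv_le μ volume s).trans (h s)

theorem le_rnDeriv_of_withDensity_le {μ : Measure ℝ} [IsFiniteMeasure μ] {u : ℝ → ℝ≥0∞}
    (hu : AEMeasurable u volume) (hac : μ ≪ volume) (h : volume.withDensity u ≤ μ) :
    ∀ᵐ x, u x ≤ μ.rnDeriv volume x := by
  refine ae_le_of_forall_setLIntegral_le_of_sigmaFinite₀ hu fun s hs _ => ?_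
  rw [← withDensity_apply _ hs, ← withDensity_apply _ hs, Measure.withDensity_rnDeriv_eq μ _ hac]
  exact h s

/-! ### Density bounds for threshold measures -/

namespace IsThresholdMeasure

variable {N : ℕ} {ν : Fin N → Measure ℝ} {μ : Measure ℝ} {W : Set (Fin N) → Prop}
  {f : Fin N → ℝ → ℝ}

theorem le_withDensity_iSup (h : IsThresholdMeasure ν μ W) [∀ i, IsProbabilityMeasure (ν i)]
    [IsProbabilityMeasure μ] (hf : ∀ i, IsDensity (f i) (ν i)) :
    μ ≤ volume.withDensity fun x => ENNReal.ofReal (⨆ i, f i x) := by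
  have : IsFiniteMeasure (volume.withDensity fun x => ENNReal.ofReal (⨆ i, f i x)) :=
    isFiniteMeasure_withDensity_ofReal
      (integrable_iSup (fun i => (hf i).integrable) fun i => (hf i).nonneg).2
  refine h.le_of_forall_le fun i => ?_
  rw [(hf i).eq_withDensity]
  exact withDensity_mono (ae_of_all _ fun x => ENNReal.ofReal_le_ofReal (le_iSup_apply f i x))

theorem withDensity_iInf_le [NeZero N] (h : IsThresholdMeasure ν μ W)
    [∀ i, IsProbabilityMeasure (ν i)]
    [IsProbabilityMeasure μ] (hf : ∀ i, IsDensity (f i) (ν i)) :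
    (volume.withDensity fun x => ENNReal.ofReal (⨅ i, f i x)) ≤ μ := by
  have key : ∀ i, (volume.withDensity fun x => ENNReal.ofReal (⨅ i, f i x)) ≤ ν i := fun i => by
    conv_rhs => rw [(hf i).eq_withDensity]
    exact withDensity_mono (ae_of_all _ fun x => ENNReal.ofReal_le_ofReal (iInf_apply_le f i x))
  -- Finiteness comes from domination by one `ν i`, hence the need for an index.
  have : IsFiniteMeasure (volume.withDensity fun x => ENNReal.ofReal (⨅ i, f i x)) :=
    isFiniteMeasure_of_le _ (key 0)
  exact h.ge_of_forall_ge key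

theorem absolutelyContinuous (h : IsThresholdMeasure ν μ W) [∀ i, IsProbabilityMeasure (ν i)]
    [IsProbabilityMeasure μ] (hf : ∀ i, IsDensity (f i) (ν i)) : μ ≪ volume :=
  (Measure.absolutelyContinuous_of_le (h.le_withDensity_iSup hf)).trans
    (withDensity_absolutelyContinuous _ _)

theorem toReal_rnDeriv_mem_Icc [NeZero N] (h : IsThresholdMeasure ν μ W)
    [∀ i, IsProbabilityMeasure (ν i)] [IsProbabilityMeasure μ]
    (hf : ∀ i, IsDensity (f i) (ν i)) :
    ∀ᵐ x, (μ.rnDeriv volume x).toReal ∈ Icc (⨅ i, f i x) (⨆ i, f i x) := by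
  have hm : AEMeasurable (fun x => ⨅ i, f i x) volume :=
    AEMeasurable.iInf fun i => (hf i).integrable.aemeasurable
  filter_upwards [rnDeriv_le_of_le_withDensity (h.le_withDensity_iSup hf),
    le_rnDeriv_of_withDensity_le hm.ennreal_ofReal (h.absolutelyContinuous hf)
      (h.withDensity_iInf_le hf), Measure.rnDeriv_lt_top μ volume,
    ae_all_iff.2 fun i => (hf i).nonneg] with x h1 h2 h3 h4
  exact ⟨(ENNReal.ofReal_le_iff_le_toReal h3.ne).1 h2,
    ENNReal.toReal_le_of_le_ofReal (Real.iSup_nonneg h4) h1⟩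

end IsThresholdMeasure

theorem medianQuantile_eq_interpolation {N : ℕ} (lam : Fin N → ℝ) (ν : Fin N → Measure ℝ)
    (θ : ℝ) : medianQuantile lam ν θ
      = fun t => (1 - θ) * medianQuantile lam ν 0 t + θ * medianQuantile lam ν 1 t := by
  ext t
  simp [medianQuantile]

/-! ### Absolute continuity and `L^p` bounds for the median selections -/

section Median

variable {N : ℕ} {lam : Fin N → ℝ} {ν : Fin N → Measure ℝ} {f : Fin N → ℝ → ℝ}

theorem hMed_zero_absolutelyContinuous (hlam : lam ∈ stdSimplex ℝ (Fin N))
    [∀ i, IsProbabilityMeasure (ν i)] (hf : ∀ i, IsDensity (f i) (ν i)) :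
    hMed lam ν 0 ≪ volume :=
  have := isProbabilityMeasure_hMed hlam ν (θ := 0) ⟨le_rfl, zero_le_one⟩
  (isThresholdMeasure_hMed_zero hlam ν).absolutelyContinuous hf

theorem hMed_one_absolutelyContinuous (hlam : lam ∈ stdSimplex ℝ (Fin N))
    [∀ i, IsProbabilityMeasure (ν i)] (hf : ∀ i, IsDensity (f i) (ν i)) :
    hMed lam ν 1 ≪ volume :=
  have := isProbabilityMeasure_hMed hlam ν (θ := 1) ⟨zero_le_one, le_rfl⟩
  (isThresholdMeasure_hMed_one hlam ν).absolutelyContinuous hf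

theorem hMed_absolutelyContinuous (hlam : lam ∈ stdSimplex ℝ (Fin N))
    [∀ i, IsProbabilityMeasure (ν i)] (hf : ∀ i, IsDensity (f i) (ν i)) {θ : ℝ}
    (hθ : θ ∈ Icc (0 : ℝ) 1) : hMed lam ν θ ≪ volume := by
  rw [hMed, medianQuantile_eq_interpolation]
  exact map_interpolation_absolutelyContinuous isOpen_Ioo hθ
    (medianQuantile_mono hlam ν ⟨le_rfl, zero_le_one⟩)
    (medianQuantile_mono hlam ν ⟨zero_le_one, le_rfl⟩)
    (hMed_zero_absolutelyContinuous hlam hf) (hMed_one_absolutelyContinuous hlam hf)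

theorem eLpNorm_rnDeriv_hMed_le (hlam : lam ∈ stdSimplex ℝ (Fin N))
    [∀ i, IsProbabilityMeasure (ν i)] (hf : ∀ i, IsDensity (f i) (ν i)) {θ : ℝ}
    (hθ : θ ∈ Icc (0 : ℝ) 1) {p : ℝ≥0∞} (hp : 1 ≤ p) :
    eLpNorm (fun x => ((hMed lam ν θ).rnDeriv volume x).toReal) p volume
      ≤ eLpNorm (fun x => ⨆ i, f i x) p volume := by
  have h0 : (0 : ℝ) ∈ Icc (0 : ℝ) 1 := ⟨le_rfl, zero_le_one⟩
  have h1 : (1 : ℝ) ∈ Icc (0 : ℝ) 1 := ⟨zero_le_one, le_rfl⟩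
  have := isProbabilityMeasure_hMed hlam ν h0
  have := isProbabilityMeasure_hMed hlam ν h1
  have := isProbabilityMeasure_hMed hlam ν hθ
  have hmap : ∀ η ∈ Icc (0 : ℝ) 1,
      Measure.map (medianQuantile lam ν η) (volume.restrict (Ioo 0 1))
        = volume.withDensity ((hMed lam ν η).rnDeriv volume) := fun η hη => by
    have := isProbabilityMeasure_hMed hlam ν hη
    exact (Measure.withDensity_rnDeriv_eq _ _ (hMed_absolutelyContinuous hlam hf hη)).symm
  have hmapθ := hmap θ hθ
  rw [medianQuantile_eq_interpolation] at hmapθ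
  have hm : ∀ η, Measurable ((hMed lam ν η).rnDeriv volume) :=
    fun η => Measure.measurable_rnDeriv _ _
  have he : ∀ᵐ x, ‖((hMed lam ν θ).rnDeriv volume x).toReal‖ₑ
      = (hMed lam ν θ).rnDeriv volume x := by
    filter_upwards [Measure.rnDeriv_lt_top (hMed lam ν θ) volume] with x hx
    rw [Real.enorm_of_nonneg ENNReal.toReal_nonneg, ENNReal.ofReal_toReal hx.ne]
  have hle : ∀ μ : Measure ℝ, [IsFiniteMeasure μ] →
      μ ≤ volume.withDensity (fun x => ENNReal.ofReal (⨆ i, f i x)) →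
      ∀ᵐ x, μ.rnDeriv volume x ≤ ‖⨆ i, f i x‖ₑ := fun μ _ hμ => by
    filter_upwards [rnDeriv_le_of_le_withDensity hμ] with x hx
    exact hx.trans (Real.ofReal_le_enorm _)
  have hle0 := hle _ ((isThresholdMeasure_hMed_zero hlam ν).le_withDensity_iSup hf)
  have hle1 := hle _ ((isThresholdMeasure_hMed_one hlam ν).le_withDensity_iSup hf)
  have hQ0 := medianQuantile_mono hlam ν h0
  have hQ1 := medianQuantile_mono hlam ν h1
  rcases eq_or_ne p ∞ with rfl | htop
  · rw [eLpNorm_exponent_top, eLpNorm_exponent_top]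
    refine essSup_le_of_ae_le _ ?_
    have hs := enorm_ae_le_eLpNormEssSup (fun x => ⨆ i, f i x) (volume : Measure ℝ)
    filter_upwards [he, density_interpolation_le_const isOpen_Ioo ordConnected_Ioo hθ hQ0 hQ1
      (hm 0) (hm 1) (hm θ) (hmap 0 h0) (hmap 1 h1) hmapθ
      (by filter_upwards [hle0, hs] with x hx hx' using hx.trans hx')
      (by filter_upwards [hle1, hs] with x hx hx' using hx.trans hx')] with x hx hx'
    rw [hx]
    exact hx'
  · have hp0 : p ≠ 0 := (zero_lt_one.trans_le hp).ne'
    have hp1 : 1 ≤ p.toReal := by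
      simpa using ENNReal.toReal_mono htop hp
    rw [eLpNorm_eq_lintegral_rpow_enorm_toReal hp0 htop,
      eLpNorm_eq_lintegral_rpow_enorm_toReal hp0 htop]
    refine ENNReal.rpow_le_rpow ?_ (by positivity)
    have hpow : ∀ g : ℝ → ℝ≥0∞, (∀ᵐ x, g x ≤ ‖⨆ i, f i x‖ₑ) →
        ∫⁻ x, g x ^ p.toReal ≤ ∫⁻ x, ‖⨆ i, f i x‖ₑ ^ p.toReal := fun g hg =>
      lintegral_mono_ae (hg.mono fun x hx => ENNReal.rpow_le_rpow hx (by positivity))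
    calc ∫⁻ x, ‖((hMed lam ν θ).rnDeriv volume x).toReal‖ₑ ^ p.toReal
        = ∫⁻ x, (hMed lam ν θ).rnDeriv volume x ^ p.toReal :=
          lintegral_congr_ae (he.mono fun x hx => by simp only [hx])
      _ ≤ _ := lintegral_density_interpolation_rpow_le isOpen_Ioo ordConnected_Ioo hθ hQ0 hQ1
          (hm 0) (hm 1) (hm θ) (hmap 0 h0) (hmap 1 h1) hmapθ hp1
      _ ≤ ENNReal.ofReal (1 - θ) * (∫⁻ x, ‖⨆ i, f i x‖ₑ ^ p.toReal)
          + ENNReal.ofReal θ * ∫⁻ x, ‖⨆ i, f i x‖ₑ ^ p.toReal :=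
          add_le_add (mul_le_mul_right (hpow _ hle0) _) (mul_le_mul_right (hpow _ hle1) _)
      _ = ∫⁻ x, ‖⨆ i, f i x‖ₑ ^ p.toReal := by
          rw [← add_mul, ← ENNReal.ofReal_add (sub_nonneg.2 hθ.2) hθ.1, sub_add_cancel,
            ENNReal.ofReal_one, one_mul]

end Median

end HorizontalMedian

theorem mainTheorem5 {N : ℕ} (lam : Fin N → ℝ) (hlam : lam ∈ stdSimplex ℝ (Fin N))
    (ν : Fin N → Measure ℝ) (hprob : ∀ i, IsProbabilityMeasure (ν i))
    (hmoment : ∀ i, Integrable (fun x : ℝ => x) (ν i))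
    (f : Fin N → ℝ → ℝ) (hf : ∀ i, HorizontalMedian.IsDensity (f i) (ν i)) :
    ∃ g : ℝ → ℝ → ℝ,
      (∀ θ ∈ Icc (0 : ℝ) 1,
        HorizontalMedian.hMed lam ν θ ≪ (volume : Measure ℝ) ∧
        HorizontalMedian.IsDensity (g θ) (HorizontalMedian.hMed lam ν θ)) ∧
      (∀ᵐ x ∂(volume : Measure ℝ),
        (⨅ i, f i x) ≤ min (g 0 x) (g 1 x) ∧
        min (g 0 x) (g 1 x) ≤ max (g 0 x) (g 1 x) ∧
        max (g 0 x) (g 1 x) ≤ ⨆ i, f i x) ∧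
      (∀ p : ℝ≥0∞, 1 ≤ p → (∀ i, MemLp (f i) p (volume : Measure ℝ)) →
        ∀ θ ∈ Icc (0 : ℝ) 1,
          MemLp (g θ) p (volume : Measure ℝ) ∧
          eLpNorm (g θ) p (volume : Measure ℝ)
            ≤ eLpNorm (fun x => ⨆ i, f i x) p (volume : Measure ℝ) ∧
          eLpNorm (fun x => ⨆ i, f i x) p (volume : Measure ℝ)
            ≤ ∑ i, eLpNorm (f i) p (volume : Measure ℝ)) := by
  open HorizontalMedian in
  -- An empty family of weights cannot sum to `1`.
  have hN : NeZero N := ⟨by rintro rfl; simpa using hlam.2⟩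
  have hP := fun θ hθ => isProbabilityMeasure_hMed hlam ν (θ := θ) hθ
  refine ⟨fun θ x => ((hMed lam ν θ).rnDeriv volume x).toReal, fun θ hθ => ?_, ?_,
    fun p hp hfp θ hθ => ?_⟩
  · have := hP θ hθ
    have hac := hMed_absolutelyContinuous hlam hf hθ
    exact ⟨hac, isDensity_toReal_rnDeriv hac⟩
  · have := hP 0 ⟨le_rfl, zero_le_one⟩
    have := hP 1 ⟨zero_le_one, le_rfl⟩
    filter_upwards [(isThresholdMeasure_hMed_zero hlam ν).toReal_rnDeriv_mem_Icc hf,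
      (isThresholdMeasure_hMed_one hlam ν).toReal_rnDeriv_mem_Icc hf] with x h0 h1
    exact ⟨le_min h0.1 h1.1, min_le_max, max_le h0.2 h1.2⟩
  · have h1 := eLpNorm_rnDeriv_hMed_le hlam hf hθ hp
    have h2 := eLpNorm_iSup_le_sum (fun i => (hf i).integrable.aestronglyMeasurable)
      (fun i => (hf i).nonneg) hp
    refine ⟨⟨?_, (h1.trans h2).trans_lt (ENNReal.sum_lt_top.2 fun i _ => (hfp i).2)⟩, h1, h2⟩
    exact (Measure.measurable_rnDeriv _ _).ennreal_toReal.aestronglyMeasurable
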